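/- **Linear branching programs.** A linear branching program $\mathcal P$ on $\mathbb F_2^n$ is a finite directed acyclic graph (parallel edges allowed) with exactly one source and exactly two sinks, labelled $0$ and $1$. Every inner node is labelled by a linear form $q:\mathbb F_2^n\to\mathbb F_2$ (its query) and has two outgoing edges, labelled $0$ and $1$. An input $x$ defines a path from the source: at a node with query $q$ it follows the edge labelled $q(x)$. $\mathcal P$ computes $g:\{0,1\}^n\to\{0,1\}$ if for every $x$ this path ends in the sink labelled $g(x)$. The size of $\mathcal P$ is its number of nodes. For an inner node $v$, let $\mathrm{Pre}_v$ be the span of all queries on paths from the source to $v$, excluding the query at $v$, and let $\mathrm{Post}_v$ be the span of all queries in the subprogram starting at $v$ (including the query at $v$). $\mathcal P$ is strongly read-once if $\mathrm{Pre}_v\cap\mathrm{Post}_v=\{0\}$ for every inner node $v$. For Boolean functions $f,g$ on $\{0,1\}^n$ let $\mathrm{dist}(f,g)=2^{-n}\,|\{x: f(x)\neq g(x)\}|$. **The function.** For $n=3k$, $k\ge 1$, and an $\mathbb F_2$-linear isomorphism $\phi:\mathbb F_2^k\to\mathbb F_{2^k}$, let $$f_\phi:\{0,1\}^k\times\{0,1\}^k\times\{0,1\}^k\to\{0,1\},\qquad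 f_\phi(x,y,z)=\mathrm{Tr}\bigl(\phi(x)\cdot\phi(y)\cdot\phi(z)\bigr),$$ where $\mathrm{Tr}(a)=\sum_{i=0}^{k-1}a^{2^i}$ is the trace from $\mathbb F_{2^k}$ to $\mathbb F_2$. For $s,t:\mathbb N\to\mathbb R$ let $H(s,t)$ be the statement: for all $n=3k$ with $k\ge1$, all $\phi$ as above, and every $g:\{0,1\}^n\to\{0,1\}$ computed by a strongly read-once linear branching program of size at most $2^{n/3-s(n)}$, $$\mathrm{dist}(f_\phi,g)\ \ge\ \tfrac12-2^{-t(n)}.$$ **Corollary** (average-case hardness for size $2^{n/3-o(n)}$ with distance $\tfrac12-2^{-o(n)}$). 1. For every $t$ with $t(n)=o(n)$ there is $s$ with $s(n)=o(n)$ such that $H(s,t)$ holds. 2. For every $s$ with $s(n)=o(n)$ and $s(n)\to\infty$ there is $t$ with $t(n)=o(n)$ and $t(n)\to\infty$ such that $H(s,t)$ holds. -/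

import Mathlib

open Filter Asymptotics

/-- A linear branching program whose input ranges over the `𝔽₂`-vector space `V`.
Its nodes are the inner nodes together with exactly two sinks, labelled by `0` and `1`. -/
structure LinearBP (V : Type) [AddCommGroup V] [Module (ZMod 2) V] where
  /-- the inner nodes -/
  Inner : Type
  /-- the program is finite -/
  [fintypeInner : Fintype Inner]
  /-- the linear form that labels an inner node -/
  query : Inner → Module.Dual (ZMod 2) V
  /-- `child v b` is the head of the edge out of `v` that is labelled `b` -/
  child : Inner → ZMod 2 → Inner ⊕ ZMod 2
  /-- the source -/
  source : Inner ⊕ ZMod 2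
  /-- `source` is the one and only node without incoming edges -/
  isSource_iff : ∀ w : Inner ⊕ ZMod 2, (∀ v b, child v b ≠ w) ↔ w = source
  /-- there is no directed cycle -/
  acyclic : ∀ w : Inner ⊕ ZMod 2,
    ¬ Relation.TransGen (fun u u' => ∃ v b, u = Sum.inl v ∧ u' = child v b) w w

namespace LinearBP

variable {V : Type} [AddCommGroup V] [Module (ZMod 2) V]

/-- The nodes of the program: `Sum.inl v` is an inner node, `Sum.inr b` is the sink labelled `b`. -/
abbrev Node (P : LinearBP V) : Type := P.Inner ⊕ ZMod 2

instance (P : LinearBP V) : Fintype P.Inner := P.fintypeInner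

/-- The number of nodes, sinks included. -/
def size (P : LinearBP V) : ℕ := Fintype.card P.Inner + Fintype.card (ZMod 2)

/-- There is an edge from `u` to `u'`. -/
def Edge (P : LinearBP V) (u u' : P.Node) : Prop :=
  ∃ v b, u = Sum.inl v ∧ u' = P.child v b

/-- There is an edge from `u` to `u'` which the input `x` follows. -/
def Step (P : LinearBP V) (x : V) (u u' : P.Node) : Prop :=
  ∃ v, u = Sum.inl v ∧ u' = P.child v (P.query v x)

/-- For every input `x`, the path defined by `x` ends in the sink labelled `g x`. -/
def Computes (P : LinearBP V) (g : V → ZMod 2) : Prop :=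
  ∀ x, Relation.ReflTransGen (P.Step x) P.source (Sum.inr (g x))

/-- The span of all queries on paths from the source to `v`, the query at `v` excluded. -/
def pre (P : LinearBP V) (v : P.Inner) : Submodule (ZMod 2) (Module.Dual (ZMod 2) V) :=
  Submodule.span (ZMod 2)
    {q | ∃ u, Relation.ReflTransGen P.Edge P.source (Sum.inl u) ∧
      Relation.TransGen P.Edge (Sum.inl u) (Sum.inl v) ∧ q = P.query u}

/-- The span of all queries in the subprogram starting at `v`, the query at `v` included. -/
def post (P : LinearBP V) (v : P.Inner) : Submodule (ZMod 2) (Module.Dual (ZMod 2) V) :=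
  Submodule.span (ZMod 2)
    {q | ∃ u, Relation.ReflTransGen P.Edge (Sum.inl v) (Sum.inl u) ∧ q = P.query u}

/-- `pre v ∩ post v = {0}` at every inner node `v`. -/
def StronglyReadOnce (P : LinearBP V) : Prop :=
  ∀ v, P.pre v ⊓ P.post v = ⊥

end LinearBP

/-- The relative distance of two Boolean functions: the fraction of inputs where they differ. -/
noncomputable def relDist {V : Type} [Fintype V] (f g : V → ZMod 2) : ℝ :=
  (hammingDist f g : ℝ) / (Fintype.card V : ℝ)

/-- The Boolean cube `{0,1}ᵏ`. -/
abbrev Cube (k : ℕ) : Type := Fin k → ZMod 2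

/-- `f(x, y, z) = Tr(φ(x) φ(y) φ(z))` with `Tr` the trace from `𝔽_{2ᵏ}` to `𝔽₂`. -/
noncomputable def traceProduct {k : ℕ} (φ : Cube k ≃ₗ[ZMod 2] GaloisField 2 k) :
    Cube k × Cube k × Cube k → ZMod 2 :=
  fun p => Algebra.trace (ZMod 2) (GaloisField 2 k) (φ p.1 * φ p.2.1 * φ p.2.2)

/-- The trace is given by the usual formula `Tr(a) = ∑_{i < k} a ^ (2 ^ i)`. -/
theorem trace_galoisField_two {k : ℕ} (hk : k ≠ 0) (a : GaloisField 2 k) :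
    algebraMap (ZMod 2) (GaloisField 2 k) (Algebra.trace (ZMod 2) (GaloisField 2 k) a) =
      ∑ i ∈ Finset.range k, a ^ 2 ^ i := by
  rw [FiniteField.algebraMap_trace_eq_sum_pow, GaloisField.finrank 2 hk]
  simp

/-- On `n = 3k` variables, every function computed by a strongly read-once linear branching program
of size at most `2 ^ (n / 3 - s n)` has distance at least `1 / 2 - 2 ^ (- t n)` from
`Tr(φ(x) φ(y) φ(z))`, for every choice of the isomorphism `φ`. -/
def AverageHard (s t : ℕ → ℝ) : Prop :=
  ∀ n k : ℕ, 0 < k → n = 3 * k →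
    ∀ (φ : Cube k ≃ₗ[ZMod 2] GaloisField 2 k) (g : Cube k × Cube k × Cube k → ZMod 2)
      (P : LinearBP (Cube k × Cube k × Cube k)),
      P.StronglyReadOnce → P.Computes g → (P.size : ℝ) ≤ (2 : ℝ) ^ ((n : ℝ) / 3 - s n) →
        1 / 2 - (2 : ℝ) ^ (-t n) ≤ relDist (traceProduct φ) g

/-!
The hardness bound comes from cutting the program, for a parameter `c ≤ k`, at the edges where the
dimension of the space of forms still to be queried drops to at most `2k + c`. Every input crosses
exactly one such edge (`LinearBP.Computes.existsUnique_cut`), so the at most `2 * size` cut edges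
partition the inputs into cells. Read-onceness says that the forms deciding whether an input is in
the cell and the forms deciding the output on the cell are linearly independent of each other
(`LinearBP.exists_splitCells`). So there are subspaces `A` and `B`, with `A + B` everything,
`dim A ≥ k - c` and `dim B ≥ 2k + c`, such that the cell is invariant under `B` and the output on it
is invariant under `A`.

On one cell, the Cauchy–Schwarz inequality eliminates the unknown output and leaves the correlations
over `B` of pairs of translates of `f` by elements of `A` (`abs_sum_cell_le`). They are exponential
sums of derivatives of `f` over translates of `B`. For `f = Tr(xyz)` the derivative in a direction
`a ≠ 0` is quadratic with polar form `(u, w) ↦ Tr(w · (a × u))`, where `×` is the cross product on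
`𝔽_{2ᵏ}³`. The kernel of `u ↦ a × u` has dimension `k` and the annihilator of `B` has dimension at
most `k - c`, so the radical on `B` has dimension at most `2k - c` and the bias is at most `2 ^ (-c)`
(`isDirectionalExtractor_trace_mul`).

The diagonal terms contribute `√(|R| |V| / 2 ^ (k - c))` on a cell `R`. Because the cells are disjoint,
a second use of Cauchy–Schwarz bounds the total of these by `√(2 * size / 2 ^ (k - c)) |V|`, and this
is what permits a size as large as `2 ^ (k - o(k))`. The off-diagonal terms add up to at most
`2 ^ (-c / 2) |V|` (`abs_sum_le_of_splitCells`). Taking `c` close to `2 t` balances the two.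
-/

/-! ### Signs and exponential sums over `𝔽₂` -/

/-- The nontrivial character `b ↦ (-1) ^ b` of `𝔽₂`, with real values. -/
noncomputable def signChar (b : ZMod 2) : ℝ := if b = 0 then 1 else -1

theorem ZMod.eq_zero_or_one_of_two (a : ZMod 2) : a = 0 ∨ a = 1 := by
  revert a; decide

theorem signChar_add (a b : ZMod 2) : signChar (a + b) = signChar a * signChar b := by
  have h2 : (1 + 1 : ZMod 2) = 0 := by decide
  rcases ZMod.eq_zero_or_one_of_two a with rfl | rfl <;>
    rcases ZMod.eq_zero_or_one_of_two b with rfl | rfl <;> simp [signChar, h2]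

theorem abs_signChar (a : ZMod 2) : |signChar a| = 1 := by
  unfold signChar; split_ifs <;> simp

theorem signChar_mul_self (a : ZMod 2) : signChar a * signChar a = 1 := by
  unfold signChar; split_ifs <;> simp

theorem sum_signChar_linear_eq_zero {B : Type*} [AddCommGroup B] [Module (ZMod 2) B] [Fintype B]
    (l : B →ₗ[ZMod 2] ZMod 2) (hl : l ≠ 0) : ∑ b, signChar (l b) = 0 := by
  obtain ⟨b₀, hb₀⟩ : ∃ b, l b ≠ 0 := by
    by_contra! h
    exact hl (LinearMap.ext h)
  have h1 : l b₀ = 1 := (ZMod.eq_zero_or_one_of_two _).resolve_left hb₀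
  have h : ∑ b, signChar (l b) = ∑ b, signChar (l (b₀ + b)) :=
    (Equiv.sum_comp (Equiv.addLeft b₀) fun b => signChar (l b)).symm
  have h' : ∑ b, signChar (l (b₀ + b)) = -∑ b, signChar (l b) := by
    rw [← Finset.sum_neg_distrib]
    refine Finset.sum_congr rfl fun b _ => ?_
    rw [map_add, signChar_add, h1]
    simp only [signChar, one_ne_zero, if_false, neg_one_mul]
  linarith

/-- Squaring the exponential sum of a function all of whose derivatives are affine leaves only the
directions in which the derivative is constant. -/
theorem sq_sum_signChar_le {B : Type*} [AddCommGroup B] [Module (ZMod 2) B] [Fintype B]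
    (h : B → ZMod 2) (l : B → B →ₗ[ZMod 2] ZMod 2) (c : B → ZMod 2)
    (hder : ∀ u b, h b + h (b + u) = l u b + c u) :
    (∑ b, signChar (h b)) ^ 2 ≤ Fintype.card B * Nat.card {u : B // l u = 0} := by
  classical
  have h1 : (∑ b, signChar (h b)) ^ 2 = ∑ u, signChar (c u) * ∑ b, signChar (l u b) := by
    calc (∑ b, signChar (h b)) ^ 2
        = ∑ b, ∑ u, signChar (h b) * signChar (h (b + u)) := by
          rw [sq, Finset.sum_mul]
          refine Finset.sum_congr rfl fun b _ => ?_
          rw [Finset.mul_sum]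
          exact (Equiv.sum_comp (Equiv.addLeft b) fun u => signChar (h b) * signChar (h u)).symm
      _ = ∑ u, ∑ b, signChar (h b) * signChar (h (b + u)) := Finset.sum_comm
      _ = _ := by
          refine Finset.sum_congr rfl fun u _ => ?_
          rw [Finset.mul_sum]
          refine Finset.sum_congr rfl fun b _ => ?_
          rw [← signChar_add, hder, add_comm, signChar_add]
  have h2 : ∀ u, signChar (c u) * ∑ b, signChar (l u b) ≤
      if l u = 0 then (Fintype.card B : ℝ) else 0 := by
    intro u
    split_ifs with hu
    · have : signChar (c u) ≤ 1 := (le_abs_self _).trans (abs_signChar _).le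
      have h0 : ∑ b, signChar (l u b) = Fintype.card B := by simp [hu, signChar]
      rw [h0]
      exact mul_le_of_le_one_left (by positivity) this
    · rw [sum_signChar_linear_eq_zero _ hu, mul_zero]
  rw [h1]
  refine (Finset.sum_le_sum fun u _ => h2 u).trans ?_
  rw [← Finset.sum_filter, Finset.sum_const, nsmul_eq_mul, mul_comm, Nat.card_eq_fintype_card,
    Fintype.card_subtype]

/-! ### Directional affine extractors -/

/-- `f` is a directional affine extractor for dimension `d` with bias `ε`: on every translate of a
subspace of dimension at least `d`, the derivative of `f` in every nonzero direction has bias at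
most `ε`. -/
def IsDirectionalExtractor {V : Type} [AddCommGroup V] [Module (ZMod 2) V]
    (f : V → ZMod 2) (d : ℕ) (ε : ℝ) : Prop :=
  ∀ (B : Submodule (ZMod 2) V) [Fintype B], d ≤ Module.finrank (ZMod 2) B →
    ∀ a : V, a ≠ 0 → ∀ x : V,
      |∑ b : B, signChar (f (x + b) + f (x + b + a))| ≤ ε * Fintype.card B

theorem finrank_comap_le {K V W : Type*} [Field K] [AddCommGroup V] [Module K V]
    [AddCommGroup W] [Module K W] [FiniteDimensional K V] [FiniteDimensional K W]
    (T : V →ₗ[K] W) (S : Submodule K W) :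
    Module.finrank K (S.comap T) ≤ Module.finrank K (LinearMap.ker T) + Module.finrank K S := by
  have h := LinearMap.finrank_range_add_finrank_ker (T.domRestrict (S.comap T))
  have h1 : Module.finrank K (LinearMap.range (T.domRestrict (S.comap T))) ≤
      Module.finrank K S := by
    apply Submodule.finrank_mono
    rintro _ ⟨x, rfl⟩
    exact x.2
  have h2 : Module.finrank K (LinearMap.ker (T.domRestrict (S.comap T))) ≤
      Module.finrank K (LinearMap.ker T) := by
    have hmem : ∀ x : LinearMap.ker (T.domRestrict (S.comap T)),
        (Submodule.subtype _ ∘ₗ Submodule.subtype _) x ∈ LinearMap.ker T := fun x => x.2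
    refine LinearMap.finrank_le_finrank_of_injective
      (f := LinearMap.codRestrict (LinearMap.ker T) _ hmem) ?_
    intro x y hxy
    have h := congrArg Subtype.val hxy
    exact Subtype.ext (Subtype.ext h)
  omega

section TraceProduct

variable {U F : Type} [AddCommGroup U] [Module (ZMod 2) U] [Field F] [Algebra (ZMod 2) F]

/-- The cross product `φ(a) × φ(u)` in `F ^ 3`, as a linear function of `u`. Signs are left out
because the characteristic is `2`. -/
noncomputable def crossLeft (φ : U ≃ₗ[ZMod 2] F) (a : U × U × U) :
    U × U × U →ₗ[ZMod 2] F × F × F :=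
  let p₁ : U × U × U →ₗ[ZMod 2] F := φ.toLinearMap ∘ₗ LinearMap.fst _ _ _
  let p₂ : U × U × U →ₗ[ZMod 2] F :=
    φ.toLinearMap ∘ₗ LinearMap.fst _ _ _ ∘ₗ LinearMap.snd _ _ _
  let p₃ : U × U × U →ₗ[ZMod 2] F :=
    φ.toLinearMap ∘ₗ LinearMap.snd _ _ _ ∘ₗ LinearMap.snd _ _ _
  let m (b : F) (p : U × U × U →ₗ[ZMod 2] F) := LinearMap.mulLeft (ZMod 2) b ∘ₗ p
  (m (φ a.2.1) p₃ + m (φ a.2.2) p₂).prod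
    ((m (φ a.1) p₃ + m (φ a.2.2) p₁).prod (m (φ a.1) p₂ + m (φ a.2.1) p₁))

theorem crossLeft_apply (φ : U ≃ₗ[ZMod 2] F) (a u : U × U × U) :
    crossLeft φ a u = (φ a.2.1 * φ u.2.2 + φ a.2.2 * φ u.2.1,
      φ a.1 * φ u.2.2 + φ a.2.2 * φ u.1, φ a.1 * φ u.2.1 + φ a.2.1 * φ u.1) := rfl

/-- The pairing of `F ^ 3` with `U ^ 3` by the trace of the dot product. -/
noncomputable def traceDot (φ : U ≃ₗ[ZMod 2] F) :
    F × F × F →ₗ[ZMod 2] Module.Dual (ZMod 2) (U × U × U) :=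
  LinearMap.mk₂ (ZMod 2)
    (fun p w => Algebra.trace (ZMod 2) F (p.1 * φ w.1 + p.2.1 * φ w.2.1 + p.2.2 * φ w.2.2))
    (fun p p' w => by
      rw [← map_add]; congr 1; simp only [Prod.fst_add, Prod.snd_add]; ring)
    (fun c p w => by
      rw [← map_smul]; congr 1; simp only [Prod.smul_fst, Prod.smul_snd, smul_add, smul_mul_assoc])
    (fun p w w' => by
      rw [← map_add]; congr 1; simp only [Prod.fst_add, Prod.snd_add, map_add]; ring)
    (fun c p w => by
      rw [← map_smul]; congr 1
      simp only [Prod.smul_fst, Prod.smul_snd, map_smul, smul_add, mul_smul_comm])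

theorem traceDot_apply (φ : U ≃ₗ[ZMod 2] F) (p : F × F × F) (w : U × U × U) :
    traceDot φ p w =
      Algebra.trace (ZMod 2) F (p.1 * φ w.1 + p.2.1 * φ w.2.1 + p.2.2 * φ w.2.2) := rfl

theorem traceDot_injective [Finite F] (φ : U ≃ₗ[ZMod 2] F) :
    Function.Injective (traceDot φ) := by
  have : Fintype F := Fintype.ofFinite F
  have key : ∀ a : F, (∀ b : F, Algebra.trace (ZMod 2) F (a * b) = 0) → a = 0 := fun a ha =>
    (traceForm_nondegenerate (ZMod 2) F).1 a ha
  rw [← LinearMap.ker_eq_bot, LinearMap.ker_eq_bot']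
  intro p hp
  have h : ∀ w, traceDot φ p w = 0 := fun w => by rw [hp]; rfl
  refine Prod.ext (key _ fun b => ?_) (Prod.ext (key _ fun b => ?_) (key _ fun b => ?_))
  · simpa [traceDot_apply] using h (φ.symm b, 0, 0)
  · simpa [traceDot_apply] using h (0, φ.symm b, 0)
  · simpa [traceDot_apply] using h (0, 0, φ.symm b)

/-- For `a ≠ 0`, the solutions of `φ(a) × φ(u) = 0` form the line spanned by `φ(a)`; here only the
upper bound on their dimension over `𝔽₂` is needed. -/
theorem finrank_ker_crossLeft_le [CharP F 2] [Finite F] (φ : U ≃ₗ[ZMod 2] F) {a : U × U × U}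
    (ha : a ≠ 0) :
    Module.finrank (ZMod 2) (LinearMap.ker (crossLeft φ a)) ≤ Module.finrank (ZMod 2) F := by
  have : Module.Finite (ZMod 2) F := Module.Finite.of_finite
  have hker : ∀ u ∈ LinearMap.ker (crossLeft φ a), φ a.2.1 * φ u.2.2 = φ a.2.2 * φ u.2.1 ∧
      φ a.1 * φ u.2.2 = φ a.2.2 * φ u.1 ∧ φ a.1 * φ u.2.1 = φ a.2.1 * φ u.1 := by
    intro u hu
    rw [LinearMap.mem_ker, crossLeft_apply, Prod.mk_eq_zero, Prod.mk_eq_zero] at hu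
    simpa only [CharTwo.add_eq_zero] using hu
  -- A coordinate of `u` at which `a` does not vanish determines `u`.
  have inj : ∀ p : U × U × U →ₗ[ZMod 2] F,
      (∀ u ∈ LinearMap.ker (crossLeft φ a), p u = 0 → u = 0) →
      Module.finrank (ZMod 2) (LinearMap.ker (crossLeft φ a)) ≤ Module.finrank (ZMod 2) F := by
    intro p hp
    refine LinearMap.finrank_le_finrank_of_injective
      (f := p.domRestrict (LinearMap.ker (crossLeft φ a))) ?_
    rw [← LinearMap.ker_eq_bot, LinearMap.ker_eq_bot']
    exact fun u hu => Subtype.ext (hp u u.2 hu)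
  by_cases h1 : φ a.1 = 0
  · by_cases h2 : φ a.2.1 = 0
    · have h3 : φ a.2.2 ≠ 0 := by
        intro h3
        simp only [map_eq_zero_iff φ φ.injective] at h1 h2 h3
        exact ha (Prod.ext h1 (Prod.ext h2 h3))
      refine inj (φ.toLinearMap ∘ₗ LinearMap.snd _ _ _ ∘ₗ LinearMap.snd _ _ _) fun u hu h0 => ?_
      obtain ⟨e1, e2, -⟩ := hker u hu
      replace h0 : φ u.2.2 = 0 := h0
      simp only [h0, mul_zero, h3, false_or, zero_eq_mul] at e1 e2
      simp only [map_eq_zero_iff φ φ.injective] at e1 e2 h0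
      exact Prod.ext e2 (Prod.ext e1 h0)
    · refine inj (φ.toLinearMap ∘ₗ LinearMap.fst _ _ _ ∘ₗ LinearMap.snd _ _ _) fun u hu h0 => ?_
      obtain ⟨e1, -, e3⟩ := hker u hu
      replace h0 : φ u.2.1 = 0 := h0
      simp only [h0, mul_zero, mul_eq_zero, h2, false_or, zero_eq_mul] at e1 e3
      simp only [map_eq_zero_iff φ φ.injective] at e1 e3 h0
      exact Prod.ext e3 (Prod.ext h0 e1)
  · refine inj (φ.toLinearMap ∘ₗ LinearMap.fst _ _ _) fun u hu h0 => ?_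
    obtain ⟨-, e2, e3⟩ := hker u hu
    replace h0 : φ u.1 = 0 := h0
    simp only [h0, mul_zero, mul_eq_zero, h1, false_or] at e2 e3
    simp only [map_eq_zero_iff φ φ.injective] at e2 e3 h0
    exact Prod.ext h0 (Prod.ext e3 e2)

/-- The second derivative of `Tr(xyz)` in the directions `a` and `u` is the affine function with
linear part `w ↦ Tr(w · (a × u))`. -/
theorem trace_mul_second_derivative [CharP F 2] (φ : U ≃ₗ[ZMod 2] F) (f : U × U × U → ZMod 2)
    (hf : ∀ p, f p = Algebra.trace (ZMod 2) F (φ p.1 * φ p.2.1 * φ p.2.2)) (a u x w : U × U × U) :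
    f (x + w) + f (x + w + a) + (f (x + w + u) + f (x + w + u + a)) =
      traceDot φ (crossLeft φ a u) w + (f x + f (x + a) + (f (x + u) + f (x + u + a))) := by
  have h2 : (2 : F) = 0 := CharTwo.two_eq_zero
  have h4 : (4 : F) = 0 := by linear_combination 2 * h2
  simp only [hf, traceDot_apply, crossLeft_apply, ← map_add]
  congr 1
  simp only [Prod.fst_add, Prod.snd_add, map_add]
  generalize φ a.1 = a1, φ a.2.1 = a2, φ a.2.2 = a3, φ u.1 = u1, φ u.2.1 = u2, φ u.2.2 = u3,
    φ x.1 = x1, φ x.2.1 = x2, φ x.2.2 = x3, φ w.1 = w1, φ w.2.1 = w2, φ w.2.2 = w3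
  rw [← sub_eq_zero]
  ring_nf
  simp only [h2, h4, mul_zero, add_zero]

/-- `Tr(xyz)` on `𝔽₂ ^ (3k)` is a directional affine extractor for dimension `2k + c` with bias
`2 ^ (-c)`. -/
theorem isDirectionalExtractor_trace_mul [CharP F 2] [Finite F] (φ : U ≃ₗ[ZMod 2] F)
    (f : U × U × U → ZMod 2)
    (hf : ∀ p, f p = Algebra.trace (ZMod 2) F (φ p.1 * φ p.2.1 * φ p.2.2)) (c : ℕ) :
    IsDirectionalExtractor f (2 * Module.finrank (ZMod 2) F + c) ((2 : ℝ)⁻¹ ^ c) := by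
  classical
  intro B _ hB a ha x
  have : Finite U := Finite.of_equiv F φ.symm.toEquiv
  have : Module.Finite (ZMod 2) U := Module.Finite.of_finite
  have : Module.Finite (ZMod 2) F := Module.Finite.of_finite
  set k := Module.finrank (ZMod 2) F with hk
  have hU : Module.finrank (ZMod 2) U = k := φ.finrank_eq
  have hV : Module.finrank (ZMod 2) (U × U × U) = 3 * k := by
    rw [Module.finrank_prod, Module.finrank_prod, hU]; ring
  let T : U × U × U →ₗ[ZMod 2] Module.Dual (ZMod 2) (U × U × U) :=
    traceDot φ ∘ₗ crossLeft φ a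
  let l : B → B →ₗ[ZMod 2] ZMod 2 := fun u => (T u).domRestrict B
  have hsq := sq_sum_signChar_le (fun b : B => f (x + b) + f (x + b + a)) l
    (fun u => f x + f (x + a) + (f (x + u) + f (x + u + a))) (fun u b => by
      have := trace_mul_second_derivative φ f hf a u x b
      simp only [Submodule.coe_add, ← add_assoc] at this ⊢
      exact this)
  -- The directions with constant derivative lie in the preimage of the annihilator of `B`.
  have hker : Module.finrank (ZMod 2) (LinearMap.ker T) ≤ k := by
    rw [LinearMap.ker_comp_of_ker_eq_bot _ (LinearMap.ker_eq_bot.2 (traceDot_injective φ))]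
    exact finrank_ker_crossLeft_le φ ha
  have hann := Subspace.finrank_add_finrank_dualAnnihilator_eq B
  have hcomap := finrank_comap_le T B.dualAnnihilator
  have hrad : Nat.card {u : B // l u = 0} ≤ 2 ^ (2 * k - c) := by
    have h1 : Nat.card {u : B // l u = 0} ≤ Nat.card (B.dualAnnihilator.comap T) := by
      refine Nat.card_le_card_of_injective (fun u => ⟨u.1.1, ?_⟩) ?_
      · rw [Submodule.mem_comap, Submodule.mem_dualAnnihilator]
        exact fun w hw => LinearMap.congr_fun u.2 ⟨w, hw⟩
      · intro u v huv
        have h := congrArg Subtype.val huv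
        exact Subtype.ext (Subtype.ext h)
    refine h1.trans ?_
    have : Fintype (B.dualAnnihilator.comap T) := Fintype.ofFinite _
    rw [Nat.card_eq_fintype_card, Module.card_eq_pow_finrank (K := ZMod 2), ZMod.card]
    exact Nat.pow_le_pow_right two_pos (by omega)
  have hcard : Fintype.card B = 2 ^ Module.finrank (ZMod 2) B := by
    rw [Module.card_eq_pow_finrank (K := ZMod 2), ZMod.card]
  have hBle : Module.finrank (ZMod 2) B ≤ 3 * k := hV ▸ Submodule.finrank_le B
  have hsmall : (Nat.card {u : B // l u = 0} : ℝ) ≤ ((2 : ℝ)⁻¹ ^ c) ^ 2 * Fintype.card B := by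
    have h1 : (Nat.card {u : B // l u = 0} : ℝ) ≤ 2 ^ (2 * k - c) := by exact_mod_cast hrad
    have h2 : ((2 : ℝ)⁻¹ ^ c) ^ 2 * 2 ^ (2 * k + c) = 2 ^ (2 * k - c) := by
      obtain ⟨e, he⟩ : ∃ e, 2 * k = c + e := ⟨2 * k - c, by omega⟩
      rw [show 2 * k + c = c * 2 + e by omega, show 2 * k - c = e by omega, pow_add, ← mul_assoc,
        ← pow_mul, ← mul_pow]
      norm_num
    rw [hcard]
    push_cast
    calc _ ≤ _ := h1
      _ = ((2 : ℝ)⁻¹ ^ c) ^ 2 * 2 ^ (2 * k + c) := h2.symm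
      _ ≤ _ := by gcongr; norm_num
  refine abs_le_of_sq_le_sq (hsq.trans ?_) (by positivity)
  calc (Fintype.card B : ℝ) * Nat.card {u : B // l u = 0}
      ≤ Fintype.card B * (((2 : ℝ)⁻¹ ^ c) ^ 2 * Fintype.card B) := by gcongr
    _ = _ := by ring

end TraceProduct

/-! ### Correlation with a function that is structured on the cells of a partition -/

section Cells

variable {V : Type} [AddCommGroup V] [Module (ZMod 2) V] [Fintype V]

/-- If `A + B` is the whole space, every vector has the same number `κ` of representations as
`a + b`. -/
theorem exists_sum_add_eq_mul_sum (A B : Submodule (ZMod 2) V) [Fintype A] [Fintype B]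
    (hAB : A ⊔ B = ⊤) :
    ∃ κ : ℝ, ∀ w : V → ℝ, ∑ b : B, ∑ a : A, w (a + b) = κ * ∑ x, w x := by
  classical
  let s : B × A → V := fun p => (p.2 : V) + p.1
  refine ⟨((Finset.univ.filter fun p : B × A => s p = 0).card : ℝ), fun w => ?_⟩
  have hfib : ∀ x : V, (Finset.univ.filter fun p : B × A => s p = x).card =
      (Finset.univ.filter fun p : B × A => s p = 0).card := by
    intro x
    obtain ⟨a, ha, b, hb, rfl⟩ := Submodule.mem_sup.1 (hAB ▸ Submodule.mem_top : x ∈ A ⊔ B)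
    refine Finset.card_bij' (fun p _ => p - (⟨b, hb⟩, ⟨a, ha⟩)) (fun p _ => p + (⟨b, hb⟩, ⟨a, ha⟩))
      ?_ ?_ (by simp) (by simp)
    · intro p hp
      simp only [Finset.mem_filter, Finset.mem_univ, true_and, s] at hp ⊢
      simp only [Prod.snd_sub, Prod.fst_sub, Submodule.coe_sub]
      rw [sub_add_sub_comm, hp, sub_self]
    · intro p hp
      simp only [Finset.mem_filter, Finset.mem_univ, true_and, s] at hp ⊢
      simp only [Prod.snd_add, Prod.fst_add, Submodule.coe_add]
      rw [add_add_add_comm, hp, zero_add]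
  rw [← Fintype.sum_prod_type' (f := fun (b : B) (a : A) => w (a + b)),
    ← Finset.sum_fiberwise Finset.univ s, Finset.mul_sum]
  refine Finset.sum_congr rfl fun x _ => ?_
  rw [Finset.sum_congr rfl (g := fun _ => w x) fun p hp => by
    rw [← (Finset.mem_filter.1 hp).2], Finset.sum_const, hfib, nsmul_eq_mul]

/-- On a set `R` that is invariant under `B`, a function that is invariant under `A` has small
correlation with a directional affine extractor. By the Cauchy–Schwarz inequality the sum over `B`
leaves correlations between pairs of translates `f (a + ·)`, `f (a' + ·)`; the diagonal pairs give
the first term of the bound and the others give the second. -/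
theorem abs_sum_cell_le {f : V → ZMod 2} {d : ℕ} {ε : ℝ} (hε : 0 ≤ ε)
    (hf : IsDirectionalExtractor f d ε) (A B : Submodule (ZMod 2) V) (hAB : A ⊔ B = ⊤)
    (hB : d ≤ Module.finrank (ZMod 2) B) (R : Finset V) (hR : ∀ x ∈ R, ∀ b ∈ B, x + b ∈ R)
    (h : V → ZMod 2) (hh : ∀ x, ∀ a ∈ A, h (x + a) = h x) :
    |∑ x ∈ R, signChar (h x + f x)| ≤
      √(R.card * (Fintype.card V / Nat.card A)) + √ε * R.card := by
  classical
  obtain ⟨κ, hκ⟩ := exists_sum_add_eq_mul_sum A B hAB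
  set S := ∑ x ∈ R, signChar (h x + f x) with hS
  set RA : Finset A := Finset.univ.filter fun a => (a : V) ∈ R with hRA
  have hmem : ∀ (a : A) (b : B), (a : V) + b ∈ R ↔ (a : V) ∈ R := fun a b =>
    ⟨fun hab => by simpa using hR _ hab (-b) (B.neg_mem b.2), fun ha => hR _ ha b b.2⟩
  have hApos : (0 : ℝ) < Fintype.card A := by exact_mod_cast Fintype.card_pos
  have hBpos : (0 : ℝ) < Fintype.card B := by exact_mod_cast Fintype.card_pos
  have hVpos : (0 : ℝ) < Fintype.card V := by exact_mod_cast Fintype.card_pos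
  have hκV : (Fintype.card B : ℝ) * Fintype.card A = κ * Fintype.card V := by
    simpa using hκ fun _ => 1
  have hκpos : 0 < κ := by
    refine pos_of_mul_pos_left ?_ hVpos.le
    rw [← hκV]; positivity
  have hκR : (Fintype.card B : ℝ) * RA.card = κ * R.card := by
    have := hκ fun x => if x ∈ R then 1 else 0
    simpa [hmem, ← hRA] using this
  have hκS : ∑ b : B, signChar (h b) * ∑ a ∈ RA, signChar (f (a + b)) = κ * S := by
    have := hκ fun x => if x ∈ R then signChar (h x + f x) else 0
    rw [Finset.sum_ite_mem, Finset.univ_inter, ← hS] at this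
    rw [← this]
    refine Finset.sum_congr rfl fun b _ => ?_
    rw [Finset.mul_sum, hRA, Finset.sum_filter]
    refine Finset.sum_congr rfl fun a _ => ?_
    simp only [hmem]
    split_ifs
    · rw [signChar_add, add_comm (a : V) b, hh _ _ a.2]
    · rfl
  have hsq : ∑ b : B, (∑ a ∈ RA, signChar (f (a + b))) ^ 2 ≤
      Fintype.card B * (RA.card + ε * RA.card ^ 2) := by
    have hpair : ∀ a a' : A, ∑ b : B, signChar (f (a + b)) * signChar (f (a' + b)) ≤
        (if a = a' then (Fintype.card B : ℝ) else 0) + ε * Fintype.card B := by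
      intro a a'
      split_ifs with haa
      · subst haa
        simp only [signChar_mul_self, Finset.sum_const, Finset.card_univ, nsmul_eq_mul, mul_one]
        exact le_add_of_nonneg_right (by positivity)
      · have hne : (a' : V) - a ≠ 0 := fun h0 => haa (Subtype.ext (sub_eq_zero.1 h0).symm)
        refine le_trans (le_of_eq ?_) ((le_abs_self _).trans
          ((hf B hB _ hne a).trans_eq (zero_add _).symm))
        refine Finset.sum_congr rfl fun b _ => ?_
        rw [← signChar_add, add_right_comm (a : V) b, add_sub_cancel]
    calc ∑ b : B, (∑ a ∈ RA, signChar (f (a + b))) ^ 2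
        = ∑ a ∈ RA, ∑ a' ∈ RA, ∑ b : B, signChar (f (a + b)) * signChar (f (a' + b)) := by
          simp only [sq, Finset.sum_mul_sum]
          rw [Finset.sum_comm]
          exact Finset.sum_congr rfl fun a _ => Finset.sum_comm
      _ ≤ ∑ a ∈ RA, ∑ a' ∈ RA,
            ((if a = a' then (Fintype.card B : ℝ) else 0) + ε * Fintype.card B) :=
          Finset.sum_le_sum fun a _ => Finset.sum_le_sum fun a' _ => hpair a a'
      _ = _ := by
          have : ∀ a ∈ RA, ∑ a' ∈ RA,
              ((if a = a' then (Fintype.card B : ℝ) else 0) + ε * Fintype.card B) =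
              Fintype.card B + RA.card * (ε * Fintype.card B) := by
            intro a ha
            rw [Finset.sum_add_distrib, Finset.sum_ite_eq, if_pos ha, Finset.sum_const,
              nsmul_eq_mul]
          rw [Finset.sum_congr rfl this, Finset.sum_const, nsmul_eq_mul]
          ring
  have hCS : (κ * S) ^ 2 ≤ Fintype.card B * (Fintype.card B * (RA.card + ε * RA.card ^ 2)) := by
    rw [← hκS]
    refine (Finset.sum_mul_sq_le_sq_mul_sq _ _ _).trans ?_
    have : ∑ b : B, signChar (h b) ^ 2 = Fintype.card B := by simp [sq, signChar_mul_self]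
    rw [this]
    gcongr
  have hS2 : S ^ 2 ≤ R.card * (Fintype.card V / Nat.card A) + ε * R.card ^ 2 := by
    rw [Nat.card_eq_fintype_card]
    have hr : (RA.card : ℝ) = κ * R.card / Fintype.card B := by
      rw [← hκR]; field_simp
    have hv : (Fintype.card V : ℝ) / Fintype.card A = Fintype.card B / κ := by
      rw [div_eq_div_iff hApos.ne' hκpos.ne']; linarith
    rw [hv]
    refine le_of_mul_le_mul_left ?_ (pow_pos hκpos 2)
    calc κ ^ 2 * S ^ 2 = (κ * S) ^ 2 := by ring
      _ ≤ _ := hCS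
      _ = _ := by rw [hr]; field_simp
  refine abs_le_of_sq_le_sq (hS2.trans ?_) (by positivity)
  have h1 : (√(R.card * (Fintype.card V / Nat.card A) : ℝ)) ^ 2 =
      R.card * (Fintype.card V / Nat.card A) := Real.sq_sqrt (by positivity)
  have h2 : (√ε) ^ 2 = ε := Real.sq_sqrt hε
  calc _ = (√(R.card * (Fintype.card V / Nat.card A) : ℝ)) ^ 2 + (√ε * R.card) ^ 2 := by
        rw [h1, mul_pow, h2]
    _ ≤ _ := by
        have : 0 ≤ √(R.card * (Fintype.card V / Nat.card A) : ℝ) * (√ε * R.card) := by positivity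
        nlinarith

/-- The restriction of `g` to the set `R` is *split* by dual subspaces `Q` and `N`: whether a
vector lies in `R` depends on the forms in `Q` only, the value of `g` on `R` depends on the forms in
`N` only, and `Q` and `N` are linearly independent of each other. The dimensions of `Q` and `N` are
at most `q` and `m`. -/
def IsSplitCell (g : V → ZMod 2) (q m : ℕ) (R : Finset V) : Prop :=
  ∃ (Q N : Submodule (ZMod 2) (Module.Dual (ZMod 2) V)) (h : V → ZMod 2),
    N ⊓ Q = ⊥ ∧ Module.finrank (ZMod 2) Q ≤ q ∧ Module.finrank (ZMod 2) N ≤ m ∧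
    (∀ x ∈ R, ∀ y, (∀ l ∈ Q, l x = l y) → y ∈ R) ∧
    (∀ x y, (∀ l ∈ N, l x = l y) → h x = h y) ∧
    ∀ x ∈ R, g x = h x

theorem Submodule.dualCoannihilator_sup_eq_top_of_inf_eq_bot
    {N Q : Submodule (ZMod 2) (Module.Dual (ZMod 2) V)} (hNQ : N ⊓ Q = ⊥) :
    N.dualCoannihilator ⊔ Q.dualCoannihilator = ⊤ := by
  rw [← Subspace.dualAnnihilator_dualCoannihilator_eq
      (W := N.dualCoannihilator ⊔ Q.dualCoannihilator), Submodule.dualAnnihilator_sup_eq,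
    Subspace.dualCoannihilator_dualAnnihilator_eq, Subspace.dualCoannihilator_dualAnnihilator_eq,
    hNQ, Submodule.dualCoannihilator_bot]

theorem abs_sum_splitCell_le {f : V → ZMod 2} {q m : ℕ} {ε : ℝ} (hε : 0 ≤ ε)
    (hn : Module.finrank (ZMod 2) V = q + m) (hf : IsDirectionalExtractor f m ε)
    {g : V → ZMod 2} {R : Finset V} (hR : IsSplitCell g q m R) :
    |∑ x ∈ R, signChar (g x + f x)| ≤ √(R.card * (Fintype.card V / 2 ^ q)) + √ε * R.card := by
  classical
  obtain ⟨Q, N, h, hNQ, hQ, hN, hRQ, hhN, hgh⟩ := hR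
  have hdQ := Subspace.finrank_add_finrank_dualCoannihilator_eq Q
  have hdN := Subspace.finrank_add_finrank_dualCoannihilator_eq N
  have hcell := abs_sum_cell_le hε hf N.dualCoannihilator Q.dualCoannihilator
    (Submodule.dualCoannihilator_sup_eq_top_of_inf_eq_bot hNQ) (by omega) R
    (fun x hx b hb => hRQ x hx _ fun l hl => by
      rw [map_add, (Submodule.mem_dualCoannihilator _).1 hb l hl, add_zero]) h
    (fun x a ha => (hhN _ _ fun l hl => by
      rw [map_add, (Submodule.mem_dualCoannihilator _).1 ha l hl, add_zero]))
  rw [Finset.sum_congr rfl fun x hx => by rw [hgh x hx]]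
  refine hcell.trans ?_
  have hA : (2 : ℝ) ^ q ≤ Nat.card N.dualCoannihilator := by
    rw [Nat.card_eq_fintype_card, Module.card_eq_pow_finrank (K := ZMod 2), ZMod.card]
    push_cast
    exact pow_le_pow_right₀ one_le_two (by omega)
  gcongr

theorem abs_sum_le_of_splitCells {f : V → ZMod 2} {q m : ℕ} {ε : ℝ} (hε : 0 ≤ ε)
    (hn : Module.finrank (ZMod 2) V = q + m) (hf : IsDirectionalExtractor f m ε)
    {g : V → ZMod 2} {ι : Type} [Fintype ι] (R : ι → Finset V)
    (hpart : ∀ x, ∃! i, x ∈ R i) (hR : ∀ i, IsSplitCell g q m (R i)) :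
    |∑ x, signChar (g x + f x)| ≤ (√(Fintype.card ι / 2 ^ q) + √ε) * Fintype.card V := by
  classical
  have hsum : ∀ w : V → ℝ, ∑ x, w x = ∑ i, ∑ x ∈ R i, w x := by
    intro w
    rw [← Finset.sum_biUnion]
    · refine Finset.sum_congr (Finset.ext fun x => ?_) fun _ _ => rfl
      simpa using (hpart x).exists
    · intro i _ j _ hij
      rw [Function.onFun, Finset.disjoint_left]
      exact fun x hi hj => hij ((hpart x).unique hi hj)
  have hcard : ∑ i, ((R i).card : ℝ) = Fintype.card V := by
    simpa using (hsum fun _ => 1).symm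
  rw [hsum]
  calc |∑ i, ∑ x ∈ R i, signChar (g x + f x)|
      ≤ ∑ i, (√((R i).card * (Fintype.card V / 2 ^ q)) + √ε * (R i).card) :=
        (Finset.abs_sum_le_sum_abs _ _).trans
          (Finset.sum_le_sum fun i _ => abs_sum_splitCell_le hε hn hf (hR i))
    _ = ∑ i, √1 * √((R i).card * (Fintype.card V / 2 ^ q)) + √ε * Fintype.card V := by
        rw [Finset.sum_add_distrib, ← Finset.mul_sum, hcard]
        simp
    _ ≤ √(∑ _i : ι, 1) * √(∑ i, (R i).card * (Fintype.card V / 2 ^ q)) +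
          √ε * Fintype.card V := by
        gcongr
        exact Real.sum_sqrt_mul_sqrt_le _ (fun _ => zero_le_one) fun _ => by positivity
    _ = _ := by
        rw [← Finset.sum_mul, hcard, ← Real.sqrt_mul (by positivity), add_mul]
        congr 1
        rw [show (∑ _i : ι, (1 : ℝ)) * (Fintype.card V * (Fintype.card V / 2 ^ q)) =
          Fintype.card ι / 2 ^ q * (Fintype.card V : ℝ) ^ 2 by simp; ring,
          Real.sqrt_mul (by positivity), Real.sqrt_sq (by positivity)]

end Cells

theorem relDist_eq_half_sub {V : Type} [Fintype V] [Nonempty V] (f g : V → ZMod 2) :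
    relDist f g = 1 / 2 - (∑ x, signChar (g x + f x)) / (2 * Fintype.card V) := by
  classical
  have hV : (Fintype.card V : ℝ) ≠ 0 := by exact_mod_cast Fintype.card_ne_zero
  have h1 : ∀ x, signChar (g x + f x) = 1 - 2 * if f x ≠ g x then 1 else 0 := by
    intro x
    have : g x + f x = 0 ↔ f x = g x := by rw [CharTwo.add_eq_zero, eq_comm]
    unfold signChar
    by_cases hx : f x = g x
    · rw [if_pos (this.2 hx), if_neg (not_not.2 hx)]; norm_num
    · rw [if_neg (mt this.1 hx), if_pos hx]; norm_num
  have h2 : ∑ x, signChar (g x + f x) = Fintype.card V - 2 * hammingDist f g := by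
    simp only [h1, Finset.sum_sub_distrib, ← Finset.mul_sum]
    rw [Finset.sum_boole, hammingDist]
    simp
  rw [h2, relDist]
  field_simp
  ring

/-! ### Cutting a strongly read-once program -/

namespace LinearBP

open Relation

variable {V : Type} [AddCommGroup V] [Module (ZMod 2) V]

/-- `post` extended to all nodes: no query is made from a sink on. -/
def postNode (P : LinearBP V) : P.Node → Submodule (ZMod 2) (Module.Dual (ZMod 2) V)
  | Sum.inl v => P.post v
  | Sum.inr _ => ⊥

theorem Step.edge {P : LinearBP V} {x : V} {u w : P.Node} (h : P.Step x u w) : P.Edge u w := by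
  obtain ⟨v, rfl, rfl⟩ := h
  exact ⟨v, _, rfl, rfl⟩

theorem step_rightUnique (P : LinearBP V) (x : V) : Relator.RightUnique (P.Step x) := by
  rintro _ _ _ ⟨v, rfl, rfl⟩ ⟨v', h, rfl⟩
  cases Sum.inl.inj h
  rfl

theorem eq_of_reflTransGen_step_sink {P : LinearBP V} {x : V} {b : ZMod 2} {w : P.Node}
    (h : ReflTransGen (P.Step x) (Sum.inr b) w) : w = Sum.inr b := by
  rcases h.cases_head with h | ⟨_, ⟨v, h, _⟩, _⟩
  · exact h.symm
  · cases h

/-- A node on the path of `x` lies on the path to the sink that `x` reaches. -/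
theorem Computes.reach_sink {P : LinearBP V} {g : V → ZMod 2} (hg : P.Computes g) {x : V}
    {w : P.Node} (hw : ReflTransGen (P.Step x) P.source w) :
    ReflTransGen (P.Step x) w (Sum.inr (g x)) := by
  rcases ReflTransGen.total_of_right_unique (P.step_rightUnique x) hw (hg x) with h | h
  · exact h
  · rw [eq_of_reflTransGen_step_sink h]

theorem query_mem_postNode (P : LinearBP V) (v : P.Inner) :
    P.query v ∈ P.postNode (Sum.inl v) :=
  Submodule.subset_span ⟨v, ReflTransGen.refl, rfl⟩

theorem postNode_le_of_edge {P : LinearBP V} {u w : P.Node} (h : P.Edge u w) :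
    P.postNode w ≤ P.postNode u := by
  rcases w with w | b
  · have h' := h
    obtain ⟨v, b, rfl, -⟩ := h'
    refine Submodule.span_mono ?_
    rintro _ ⟨u, hu, rfl⟩
    exact ⟨u, ReflTransGen.head h hu, rfl⟩
  · exact bot_le

theorem postNode_le_of_reach {P : LinearBP V} {x : V} {u w : P.Node}
    (h : ReflTransGen (P.Step x) u w) : P.postNode w ≤ P.postNode u := by
  induction h with
  | refl => exact le_rfl
  | tail _ hs ih => exact (postNode_le_of_edge hs.edge).trans ih

/-- From `u` on, the path of an input depends on the forms in `postNode u` only. -/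
theorem reach_congr_of_postNode {P : LinearBP V} {x y : V} {u w : P.Node}
    (h : ReflTransGen (P.Step x) u w) (hxy : ∀ l ∈ P.postNode u, l x = l y) :
    ReflTransGen (P.Step y) u w := by
  induction h using ReflTransGen.head_induction_on with
  | refl => exact ReflTransGen.refl
  | head hs _ ih =>
    have hle := postNode_le_of_edge hs.edge
    obtain ⟨v, rfl, rfl⟩ := hs
    refine ReflTransGen.head ⟨v, rfl, ?_⟩ (ih fun l hl => hxy l (hle hl))
    rw [hxy _ (P.query_mem_postNode v)]

theorem reach_edge {P : LinearBP V} {x : V} {u w : P.Node}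
    (h : ReflTransGen (P.Step x) u w) : ReflTransGen P.Edge u w :=
  ReflTransGen.mono (fun _ _ hs => Step.edge hs) _ _ h

/-- Whether the path of an input arrives at `v` depends on the forms in `pre v` only. -/
theorem reach_congr_of_pre {P : LinearBP V} {x y : V} {v : P.Inner}
    (h : ReflTransGen (P.Step x) P.source (Sum.inl v)) (hxy : ∀ l ∈ P.pre v, l x = l y) :
    ReflTransGen (P.Step y) P.source (Sum.inl v) := by
  have aux : ∀ w : P.Node, ReflTransGen (P.Step x) P.source w →
      ReflTransGen P.Edge w (Sum.inl v) → ReflTransGen (P.Step y) P.source w := by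
    intro w hw
    induction hw with
    | refl => exact fun _ => ReflTransGen.refl
    | tail hu hs ih =>
      intro hv
      have hedge := hs.edge
      refine ReflTransGen.tail (ih (ReflTransGen.head hedge hv)) ?_
      obtain ⟨u, rfl, rfl⟩ := hs
      refine ⟨u, rfl, ?_⟩
      rw [hxy (P.query u) (Submodule.subset_span
        ⟨u, reach_edge hu, TransGen.head' hedge hv, rfl⟩)]
  exact aux _ h ReflTransGen.refl

theorem pre_sup_span_query_le {P : LinearBP V} {v w : P.Inner}
    (hv : ReflTransGen P.Edge P.source (Sum.inl v)) (h : P.Edge (Sum.inl v) (Sum.inl w)) :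
    P.pre v ⊔ Submodule.span (ZMod 2) {P.query v} ≤ P.pre w := by
  refine sup_le (Submodule.span_mono ?_) (Submodule.span_le.2 ?_)
  · rintro _ ⟨u, hu, huv, rfl⟩
    exact ⟨u, hu, huv.tail h, rfl⟩
  · rintro _ rfl
    exact Submodule.subset_span ⟨v, hv, TransGen.single h, rfl⟩

/-- The output of the subprogram starting at `w` depends on the forms in `postNode w` only, and on
the inputs whose path arrives at `w` it is the output of the program. -/
theorem Computes.exists_output {P : LinearBP V} {g : V → ZMod 2} (hg : P.Computes g)
    (w : P.Node) : ∃ h : V → ZMod 2,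
      (∀ x y, (∀ l ∈ P.postNode w, l x = l y) → h x = h y) ∧
      ∀ x, ReflTransGen (P.Step x) P.source w → g x = h x := by
  classical
  refine ⟨fun x => if ReflTransGen (P.Step x) w (Sum.inr 1) then 1 else 0, fun x y hxy => ?_,
    fun x hx => ?_⟩
  · have : ReflTransGen (P.Step x) w (Sum.inr 1) ↔ ReflTransGen (P.Step y) w (Sum.inr 1) :=
      ⟨fun h => reach_congr_of_postNode h hxy,
        fun h => reach_congr_of_postNode h fun l hl => (hxy l hl).symm⟩
    simp only [this]
  · have hs := hg.reach_sink hx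
    beta_reduce
    rcases ZMod.eq_zero_or_one_of_two (g x) with h0 | h1
    · rw [if_neg, h0]
      intro h
      have : (Sum.inr (g x) : P.Node) = Sum.inr 1 := by
        rcases ReflTransGen.total_of_right_unique (P.step_rightUnique x) hs h with h | h
        · exact (eq_of_reflTransGen_step_sink h).symm
        · exact eq_of_reflTransGen_step_sink h
      rw [h0] at this
      exact absurd (Sum.inr.inj this) (by decide)
    · rw [h1] at hs ⊢
      rw [if_pos hs]

section Cut

variable [Fintype V]

/-- A path from the source to a sink crosses exactly one edge at which the dimension of `postNode`
drops to `m` or below, unless it is that small at the source. -/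
theorem Computes.existsUnique_cut {P : LinearBP V} {g : V → ZMod 2} (hg : P.Computes g) {m : ℕ}
    (hsrc : m < Module.finrank (ZMod 2) (P.postNode P.source)) (x : V) :
    ∃! v : P.Inner, m < Module.finrank (ZMod 2) (P.post v) ∧
      Module.finrank (ZMod 2) (P.postNode (P.child v (P.query v x))) ≤ m ∧
      ReflTransGen (P.Step x) P.source (Sum.inl v) := by
  have hex : ∀ w, ReflTransGen (P.Step x) P.source w →
      m < Module.finrank (ZMod 2) (P.postNode w) ∨
      ∃ v : P.Inner, m < Module.finrank (ZMod 2) (P.post v) ∧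
        Module.finrank (ZMod 2) (P.postNode (P.child v (P.query v x))) ≤ m ∧
        ReflTransGen (P.Step x) P.source (Sum.inl v) := by
    intro w hw
    induction hw with
    | refl => exact Or.inl hsrc
    | tail hu hs ih =>
      rcases ih with ih | ih
      · obtain ⟨v, rfl, rfl⟩ := hs
        rcases lt_or_ge m (Module.finrank (ZMod 2) (P.postNode (P.child v (P.query v x))))
          with h | h
        · exact Or.inl h
        · exact Or.inr ⟨v, ih, h, hu⟩
      · exact Or.inr ih
  -- Two distinct crossings would be comparable along the path, but `postNode` never grows again.
  have huniq : ∀ v v' : P.Inner, ReflTransGen (P.Step x) (Sum.inl v) (Sum.inl v') →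
      Module.finrank (ZMod 2) (P.postNode (P.child v (P.query v x))) ≤ m →
      m < Module.finrank (ZMod 2) (P.post v') → v' = v := by
    intro v v' hvv' hlow hhigh
    rcases hvv'.cases_head with h | ⟨w, ⟨u, hu, rfl⟩, hw⟩
    · exact (Sum.inl.inj h).symm
    · cases Sum.inl.inj hu
      exact absurd ((Submodule.finrank_mono (postNode_le_of_reach hw)).trans hlow)
        (not_le.2 hhigh)
  obtain ⟨v, hv⟩ := (hex _ (hg x)).resolve_left (by
    rw [show P.postNode (Sum.inr (g x)) = ⊥ from rfl, finrank_bot]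
    exact not_lt.2 m.zero_le)
  refine ⟨v, hv, fun v' hv' => ?_⟩
  rcases ReflTransGen.total_of_right_unique (P.step_rightUnique x) hv.2.2 hv'.2.2 with h | h
  · exact huniq _ _ h hv.2.1 hv'.1
  · exact (huniq _ _ h hv'.2.1 hv.1).symm

/-- The inputs of a strongly read-once program are partitioned, by the edge at which their path
crosses the cut, into at most `2 * size` split cells. -/
theorem exists_splitCells {P : LinearBP V} (hP : P.StronglyReadOnce) {g : V → ZMod 2}
    (hg : P.Computes g) {q m : ℕ} (hn : Module.finrank (ZMod 2) V = q + m) :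
    ∃ (ι : Type) (_ : Fintype ι) (R : ι → Finset V), Fintype.card ι ≤ 2 * P.size ∧
      (∀ x, ∃! i, x ∈ R i) ∧ ∀ i, IsSplitCell g q m (R i) := by
  classical
  rcases le_or_gt (Module.finrank (ZMod 2) (P.postNode P.source)) m with hsrc | hsrc
  · obtain ⟨h, hcongr, hgh⟩ := hg.exists_output P.source
    refine ⟨Unit, inferInstance, fun _ => Finset.univ, ?_, fun x => ⟨(), by simp, by simp⟩,
      fun _ => ⟨⊥, P.postNode P.source, h, inf_bot_eq _, by simp, hsrc, by simp, hcongr,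
        fun x _ => hgh x ReflTransGen.refl⟩⟩
    simp only [size, Fintype.card_unit, ZMod.card]
    omega
  · let cut : P.Inner × ZMod 2 → Prop := fun e =>
      m < Module.finrank (ZMod 2) (P.post e.1) ∧
        Module.finrank (ZMod 2) (P.postNode (P.child e.1 e.2)) ≤ m
    refine ⟨{e // cut e}, inferInstance, fun e => Finset.univ.filter fun x =>
      ReflTransGen (P.Step x) P.source (Sum.inl e.1.1) ∧ P.query e.1.1 x = e.1.2, ?_,
      fun x => ?_, ?_⟩
    · refine (Fintype.card_subtype_le _).trans ?_
      rw [Fintype.card_prod, size, ZMod.card]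
      omega
    · obtain ⟨v, ⟨hv1, hv2, hv3⟩, huniq⟩ := hg.existsUnique_cut hsrc x
      refine ⟨⟨(v, P.query v x), hv1, hv2⟩, by simpa using hv3, ?_⟩
      rintro ⟨⟨v', b⟩, h1, h2⟩ hx
      simp only [Finset.mem_filter, Finset.mem_univ, true_and] at hx
      obtain ⟨hx, rfl⟩ := hx
      cases huniq v' ⟨h1, h2, hx⟩
      rfl
    · rintro ⟨⟨v, b⟩, hhigh, hlow⟩
      obtain ⟨h, hcongr, hgh⟩ := hg.exists_output (P.child v b)
      by_cases hreach : ReflTransGen P.Edge P.source (Sum.inl v)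
      · refine ⟨P.pre v ⊔ Submodule.span (ZMod 2) {P.query v}, P.postNode (P.child v b), h,
          ?_, ?_, hlow, ?_, hcongr, ?_⟩
        · rcases hw : P.child v b with w | s
          · rw [inf_comm, eq_bot_iff, ← hP w]
            exact inf_le_inf_right _ (pre_sup_span_query_le hreach ⟨v, b, rfl, hw.symm⟩)
          · exact bot_inf_eq _
        · have h1 := Submodule.finrank_add_finrank_le_of_disjoint (disjoint_iff.2 (hP v))
          rw [Subspace.dual_finrank_eq, hn] at h1
          have h2 := Submodule.finrank_add_le_finrank_add_finrank (P.pre v)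
            (Submodule.span (ZMod 2) {P.query v})
          have h3 : Module.finrank (ZMod 2) (Submodule.span (ZMod 2) {P.query v}) ≤ 1 :=
            (finrank_span_le_card _).trans (by simp)
          have h4 : m < Module.finrank (ZMod 2) (P.post v) := hhigh
          omega
        · intro x hx y hxy
          simp only [Finset.mem_filter, Finset.mem_univ, true_and] at hx ⊢
          refine ⟨reach_congr_of_pre hx.1 fun l hl => hxy l (Submodule.mem_sup_left hl), ?_⟩
          rw [← hxy _ (Submodule.mem_sup_right (Submodule.mem_span_singleton_self _))]
          exact hx.2
        · intro x hx
          simp only [Finset.mem_filter, Finset.mem_univ, true_and] at hx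
          obtain ⟨hx, rfl⟩ := hx
          exact hgh x (hx.tail ⟨v, rfl, rfl⟩)
      -- The cell of an edge that cannot be reached is empty.
      · refine ⟨⊥, ⊥, 0, inf_bot_eq _, by simp, by simp, ?_, by simp, ?_⟩
        all_goals
          intro x hx
          exact absurd (reach_edge (Finset.mem_filter.1 hx).2.1) hreach

end Cut

end LinearBP

/-! ### Average-case hardness -/

/-- The hardness bound for a fixed program, with the height `2k + c` of the cut as a parameter. -/
theorem half_sub_le_relDist_traceProduct {k c : ℕ} (hk : k ≠ 0) (hc : c ≤ k)
    (φ : Cube k ≃ₗ[ZMod 2] GaloisField 2 k) (g : Cube k × Cube k × Cube k → ZMod 2)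
    (P : LinearBP (Cube k × Cube k × Cube k)) (hP : P.StronglyReadOnce) (hg : P.Computes g) :
    1 / 2 - (√(2 * P.size / 2 ^ (k - c)) + √((2 : ℝ)⁻¹ ^ c)) / 2 ≤
      relDist (traceProduct φ) g := by
  have hext := isDirectionalExtractor_trace_mul φ (traceProduct φ) (fun _ => rfl) c
  rw [GaloisField.finrank 2 hk] at hext
  have hn : Module.finrank (ZMod 2) (Cube k × Cube k × Cube k) = (k - c) + (2 * k + c) := by
    simp only [Module.finrank_prod, Module.finrank_fin_fun]
    omega
  obtain ⟨ι, _, R, hι, hpart, hR⟩ := LinearBP.exists_splitCells hP hg hn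
  have hsum := abs_sum_le_of_splitCells (by positivity) hn hext R hpart hR
  have hV : (0 : ℝ) < Fintype.card (Cube k × Cube k × Cube k) := by
    exact_mod_cast Fintype.card_pos
  rw [relDist_eq_half_sub, sub_le_sub_iff_left, div_le_div_iff₀ (by positivity) two_pos]
  have hι' : (Fintype.card ι : ℝ) ≤ 2 * P.size := by exact_mod_cast hι
  calc _ ≤ (√(Fintype.card ι / 2 ^ (k - c)) + √((2 : ℝ)⁻¹ ^ c)) *
        Fintype.card (Cube k × Cube k × Cube k) * 2 := by
        gcongr
        exact (le_abs_self _).trans hsum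
    _ ≤ (√(2 * P.size / 2 ^ (k - c)) + √((2 : ℝ)⁻¹ ^ c)) *
        Fintype.card (Cube k × Cube k × Cube k) * 2 := by gcongr
    _ = _ := by ring

theorem relDist_nonneg {V : Type} [Fintype V] (f g : V → ZMod 2) : 0 ≤ relDist f g := by
  unfold relDist; positivity

/-- `s` and `t` are admissible as soon as at every `n` with `t n > 1` there is a suitable parameter
`c` for the cut. The bound is void where `t n ≤ 1`. -/
theorem averageHard_of_exists_cut {s t : ℕ → ℝ}
    (h : ∀ n, 1 < t n → ∃ c : ℕ, 2 * t n ≤ c ∧ c + 2 * t n + 1 ≤ s n) : AverageHard s t := by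
  intro n k hk hn φ g P hP hg hsize
  rcases le_or_gt (t n) 1 with ht | ht
  · refine le_trans ?_ (relDist_nonneg _ _)
    have : (2 : ℝ) ^ (-1 : ℝ) ≤ 2 ^ (-t n) :=
      Real.rpow_le_rpow_of_exponent_le one_le_two (by linarith)
    rw [Real.rpow_neg_one] at this
    linarith
  obtain ⟨c, hc1, hc2⟩ := h n ht
  have hn3 : (n : ℝ) / 3 = k := by rw [hn]; push_cast; ring
  rw [hn3] at hsize
  -- The program has two sinks, so the bound on its size leaves room for the cut.
  have hck : c ≤ k := by
    by_contra! hck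
    have h1 : (2 : ℝ) ≤ P.size := by
      have : 2 ≤ P.size := by simp [LinearBP.size, ZMod.card]
      exact_mod_cast this
    have h2 : (2 : ℝ) ^ ((k : ℝ) - s n) ≤ 2 ^ (0 : ℝ) := by
      have : (k : ℝ) < c := by exact_mod_cast hck
      exact Real.rpow_le_rpow_of_exponent_le one_le_two (by linarith)
    rw [Real.rpow_zero] at h2
    linarith
  refine le_trans ?_ (half_sub_le_relDist_traceProduct hk.ne' hck φ g P hP hg)
  have hsq : ((2 : ℝ) ^ (-t n)) ^ 2 = 2 ^ (-(2 * t n)) := by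
    rw [← Real.rpow_natCast, ← Real.rpow_mul two_pos.le]
    congr 1; push_cast; ring
  have hA : √(2 * P.size / 2 ^ (k - c)) ≤ (2 : ℝ) ^ (-t n) := by
    rw [Real.sqrt_le_left (by positivity), hsq, ← Real.rpow_natCast, Nat.cast_sub hck,
      div_le_iff₀ (by positivity), ← Real.rpow_add two_pos]
    calc (2 : ℝ) * P.size ≤ 2 ^ (1 : ℝ) * 2 ^ ((k : ℝ) - s n) := by
          rw [Real.rpow_one]; gcongr
      _ = 2 ^ (1 + ((k : ℝ) - s n)) := (Real.rpow_add two_pos _ _).symm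
      _ ≤ _ := Real.rpow_le_rpow_of_exponent_le one_le_two (by linarith)
  have hB : √((2 : ℝ)⁻¹ ^ c) ≤ (2 : ℝ) ^ (-t n) := by
    rw [Real.sqrt_le_left (by positivity), hsq, inv_pow, ← Real.rpow_natCast,
      ← Real.rpow_neg two_pos.le]
    exact Real.rpow_le_rpow_of_exponent_le one_le_two (by linarith)
  linarith

theorem mainTheorem4 :
    (∀ t : ℕ → ℝ, t =o[atTop] (fun n : ℕ => (n : ℝ)) →
      ∃ s : ℕ → ℝ, s =o[atTop] (fun n : ℕ => (n : ℝ)) ∧ AverageHard s t) ∧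
    (∀ s : ℕ → ℝ, s =o[atTop] (fun n : ℕ => (n : ℝ)) → Tendsto s atTop atTop →
      ∃ t : ℕ → ℝ, t =o[atTop] (fun n : ℕ => (n : ℝ)) ∧ Tendsto t atTop atTop ∧
        AverageHard s t) := by
  have hconst : ∀ C : ℝ, (fun _ : ℕ => C) =o[atTop] (fun n : ℕ => (n : ℝ)) := fun C =>
    isLittleO_const_left.2 (Or.inr (tendsto_norm_atTop_atTop.comp tendsto_natCast_atTop_atTop))
  -- With the cut parameter `c = ⌈2 t⌉`, admissibility reduces to `s ≥ 4 t + 2`.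
  refine ⟨fun t ht => ⟨fun n => 4 * t n + 2, (ht.const_mul_left 4).add (hconst 2),
    averageHard_of_exists_cut fun n hn => ⟨⌈2 * t n⌉₊, Nat.le_ceil _, ?_⟩⟩,
    fun s hs hs_top => ⟨fun n => s n / 4 - 1 / 2, ?_, ?_,
      averageHard_of_exists_cut fun n hn => ⟨⌈2 * (s n / 4 - 1 / 2)⌉₊, Nat.le_ceil _, ?_⟩⟩⟩
  · have := Nat.ceil_lt_add_one (show 0 ≤ 2 * t n by linarith)
    linarith
  · simpa only [div_eq_inv_mul] using (hs.const_mul_left 4⁻¹).sub (hconst (1 / 2))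
  · simpa only [sub_eq_add_neg] using
      tendsto_atTop_add_const_right atTop (-(1 / 2)) (hs_top.atTop_div_const four_pos)
  · have := Nat.ceil_lt_add_one (show 0 ≤ 2 * (s n / 4 - 1 / 2) by linarith)
    linarith
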